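/- Let $W$ be a Coxeter group with finite set $S$ of simple reflections and Coxeter matrix $(m_{st})$, $m_{st}\in\{1,2,\dots\}\cup\{\infty\}$. Let $V=\mathbb R^S$ with standard basis $\{r_s\}_{s\in S}$ (the simple roots) and the symmetric bilinear form with $(r_s,r_t)=-\cos(\pi/m_{st})$, and $(r_s,r_t)=-1$ if $m_{st}=\infty$. Let $W$ act on $V$ by $s\,v=v-2(r_s,v)r_s$ for $s\in S$. The roots are the vectors $xr_s$ ($x\in W$, $s\in S$); a root is positive (negative) if all its coordinates are $\ge0$ ($\le 0$). For $w\in W$ let $R(w)$ be the set of positive roots $r$ such that $w^{-1}r$ is negative. *The set $C(w)$.* If $\lambda:R(w)\to\mathbb N_+$ and $s\in S$ satisfies $\ell(ws)>\ell(w)$, define $\Phi(\lambda,s):R(ws)\to\mathbb N_+$, $\lambda'=\Phi(\lambda,s)$, as follows: $\lambda'(r)=\lambda(r)$ if $r\in R(w)$; if $r\notin R(w)$, $r$ is simple and no $r'\in R(w)$ satisfies $(r,r')>0$, then $\lambda'(r)=1$; otherwise $\lambda'(r)=\lambda(r')+1$, where $r'\in R(w)$ and $\lambda(r')$ is maximal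 with respect to the property $(r,r')>0$. Let $C(e)$ consist of the empty function, and for $w\neq e$ let $C(w)$ consist of exactly the functions $\Phi(\lambda,s)$ with $s\in S$, $\ell(ws)<\ell(w)$ and $\lambda\in C(ws)$. *Word posets.* A word poset is a finite poset $P$ with a map $\sigma:P\to S$ such that (a) $u,v$ are comparable whenever $\sigma(u),\sigma(v)$ are equal or do not commute, and (b) if $v$ covers $u$, then $\sigma(u),\sigma(v)$ are equal or do not commute. An isomorphism of word posets is a poset isomorphism preserving $\sigma$. For a word $\mathbf w=\mathbf w_1\cdots\mathbf w_k$ in $S$, $P(\mathbf w)$ is the word poset $\{1,\dots,k\}$ with $\sigma(i)=\mathbf w_i$, whose order is the transitive closure of the relation "$i\le j$, and $\mathbf w_i,\mathbf w_j$ are equal or do not commute". Put $\phi_{\mathbf w}(i)=\mathbf w_1\cdots\mathbf w_{i-1}r_{\mathbf w_i}$. A word poset $P$ is a reduced word poset for $w$ if $P\cong P(\mathbf w)$ for some reduced word $\mathbf w$ for $w$. Let $\mathrm{dp}(u)$ be the largest number of elements of a strictly increasing sequence in $P$ ending in $u$. **Theorem.** Let $w\in W$. For each reduced word poset $P$ for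 $w$, the map $\phi_P=\phi_{\mathbf w}\circ f$ is the same for all words $\mathbf w$ and all isomorphisms $f:P\to P(\mathbf w)$, and it is a bijection from $P$ onto $R(w)$. Writing $\lambda_P(r)=\mathrm{dp}(\phi_P^{-1}(r))$ for $r\in R(w)$, $$C(w)=\{\lambda_P : P \text{ is a reduced word poset for } w\}.$$ -/

import Mathlib

universe v v' u t

/-! ### Word posets -/

section WordPosets

/-- Two symbols are *dependent* if they are equal or do not commute in the monoid `M`; here
`g : S → M` sends a symbol to the element of `M` that it represents. -/
def Dependent {S M : Type*} [Monoid M] (g : S → M) (a b : S) : Prop :=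
  a = b ∨ ¬ Commute (g a) (g b)

/-- A *word poset*: a finite poset with labels in the set of symbols `S` such that elements whose
labels are equal or do not commute are comparable, and such that the labels along every covering
relation are equal or do not commute. -/
structure WordPoset {S : Type u} {M : Type t} [Monoid M] (g : S → M) where
  carrier : Type v
  [order : PartialOrder carrier]
  [finite : Finite carrier]
  label : carrier → S
  comparable : ∀ u v : carrier, Dependent g (label u) (label v) → u ≤ v ∨ v ≤ u
  dependent_of_covBy : ∀ u v : carrier, u ⋖ v → Dependent g (label u) (label v)

attribute [instance] WordPoset.order WordPoset.finite

/-- An isomorphism of word posets: a poset isomorphism that preserves the labels. -/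
structure WordPoset.Iso {S : Type u} {M : Type t} [Monoid M] {g : S → M}
    (P : WordPoset.{v} g) (Q : WordPoset.{v'} g) where
  toOrderIso : P.carrier ≃o Q.carrier
  label_eq : ∀ p : P.carrier, Q.label (toOrderIso p) = P.label p

/-- The set of positions of the word `ω` (numbered from `0`), carrying the partial order
`≤_ω` below rather than the order of `Fin`. -/
def WordIndex {S M : Type*} [Monoid M] (_g : S → M) (ω : List S) : Type := Fin ω.length

/-- The position, as an element of `Fin ω.length`. -/
def WordIndex.pos {S M : Type*} [Monoid M] {g : S → M} {ω : List S} (i : WordIndex g ω) :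
    Fin ω.length := i

/-- The letter at a position. -/
def WordIndex.letter {S M : Type*} [Monoid M] {g : S → M} {ω : List S} (i : WordIndex g ω) : S :=
  ω.get i.pos

/-- The relation `i → j`: `i ≤ j`, and the letters at `i` and `j` are equal or do not commute. -/
def WordIndex.Arrow {S M : Type*} [Monoid M] {g : S → M} {ω : List S}
    (i j : WordIndex g ω) : Prop :=
  i.pos ≤ j.pos ∧ Dependent g i.letter j.letter

theorem WordIndex.pos_le_of_transGen {S M : Type*} [Monoid M] {g : S → M} {ω : List S}
    {i j : WordIndex g ω} (h : Relation.TransGen WordIndex.Arrow i j) : i.pos ≤ j.pos := by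
  induction h with
  | single h => exact h.1
  | tail _ h ih => exact le_trans ih h.1

/-- The partial order `≤_ω`, the transitive closure of `→`. -/
instance WordIndex.instPartialOrder {S M : Type*} [Monoid M] (g : S → M) (ω : List S) :
    PartialOrder (WordIndex g ω) where
  le := Relation.TransGen WordIndex.Arrow
  le_refl i := Relation.TransGen.single ⟨le_refl _, Or.inl rfl⟩
  le_trans _ _ _ h h' := h.trans h'
  le_antisymm _ _ h h' :=
    Fin.le_antisymm (WordIndex.pos_le_of_transGen h) (WordIndex.pos_le_of_transGen h')

instance WordIndex.instFinite {S M : Type*} [Monoid M] (g : S → M) (ω : List S) :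
    Finite (WordIndex g ω) :=
  inferInstanceAs (Finite (Fin ω.length))

theorem WordIndex.le_of_arrow {S M : Type*} [Monoid M] {g : S → M} {ω : List S}
    {i j : WordIndex g ω} (h : i.Arrow j) : i ≤ j :=
  Relation.TransGen.single h

theorem WordIndex.arrow_of_covBy {S M : Type*} [Monoid M] {g : S → M} {ω : List S}
    {i j : WordIndex g ω} (h : i ⋖ j) : i.Arrow j := by
  have h' : Relation.TransGen WordIndex.Arrow i j := h.le
  induction h' using Relation.TransGen.head_induction_on with
  | single hs => exact hs
  | @head a c hac hcj ih =>
    rcases h.eq_or_eq (WordIndex.le_of_arrow hac) hcj with hc | hc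
    · subst hc
      exact ih h
    · subst hc
      exact hac

/-- The word poset `P(ω)` of a word `ω`. -/
def WordPoset.ofWord {S : Type u} {M : Type t} [Monoid M] (g : S → M) (ω : List S) :
    WordPoset.{0} g where
  carrier := WordIndex g ω
  label i := i.letter
  comparable i j h := by
    rcases le_total i.pos j.pos with hij | hij
    · exact Or.inl (WordIndex.le_of_arrow ⟨hij, h⟩)
    · refine Or.inr (WordIndex.le_of_arrow ⟨hij, ?_⟩)
      rcases h with h | h
      · exact Or.inl h.symm
      · exact Or.inr fun hc => h hc.symm
  dependent_of_covBy _ _ h := (WordIndex.arrow_of_covBy h).2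

/-- The depth `dp(u)`: the largest number of elements of a strictly increasing sequence that ends
in `u`. (`Order.height u` is the largest number of steps of such a sequence; it is finite when
the poset is.) -/
noncomputable def depth {α : Type*} [PartialOrder α] (u : α) : ℕ+ :=
  Nat.succPNat (Order.height u).toNat

end WordPosets

/-! ### The root system of a Coxeter group -/

section Roots

variable {B : Type*} [Fintype B] [DecidableEq B]

/-- The simple root `r_s` in `V = B → ℝ`. -/
def simpleRoot (s : B) : B → ℝ := Pi.single s 1

/-- The bilinear form on `V`. In a `CoxeterMatrix` the entry `0` stands for `∞`. -/
noncomputable def rootForm (M : CoxeterMatrix B) : LinearMap.BilinForm ℝ (B → ℝ) :=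
  Matrix.toBilin' (Matrix.of fun s t => if M s t = 0 then -1 else -Real.cos (Real.pi / M s t))

theorem rootForm_simpleRoot (M : CoxeterMatrix B) (s t : B) :
    rootForm M (simpleRoot s) (simpleRoot t) =
      if M s t = 0 then -1 else -Real.cos (Real.pi / M s t) := by
  simp [rootForm, simpleRoot, Matrix.toBilin'_single]

theorem two_rootForm_self (M : CoxeterMatrix B) (s : B) :
    ((2 : ℝ) • rootForm M (simpleRoot s)) (simpleRoot s) = 2 := by
  simp [rootForm_simpleRoot]

/-- The reflection `v ↦ v - 2 (r_s, v) r_s`. -/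
noncomputable def simpleReflection (M : CoxeterMatrix B) (s : B) : (B → ℝ) ≃ₗ[ℝ] (B → ℝ) :=
  Module.reflection (two_rootForm_self M s)

theorem simpleReflection_apply (M : CoxeterMatrix B) (s : B) (v : B → ℝ) :
    simpleReflection M s v = v - (2 * rootForm M (simpleRoot s) v) • simpleRoot s := by
  simp [simpleReflection, Module.reflection_apply]

open Polynomial.Chebyshev in
/-- The reflections satisfy the defining relations of the Coxeter group. -/
theorem simpleReflection_isLiftable (M : CoxeterMatrix B) :
    M.IsLiftable (simpleReflection M) := by
  intro s t
  by_cases hst : s = t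
  · subst hst
    rw [M.diagonal, pow_one]
    ext1 v
    exact Module.involutive_reflection (two_rootForm_self M s) v
  by_cases h0 : M s t = 0
  · rw [h0, pow_zero]
  have h1 : M s t ≠ 1 := M.off_diagonal s t hst
  set m := M s t with hm
  have hx : ((2 : ℝ) • rootForm M (simpleRoot s)) (simpleRoot t) = -2 * Real.cos (Real.pi / m) := by
    simp [rootForm_simpleRoot, ← hm, h0]
  have hy : ((2 : ℝ) • rootForm M (simpleRoot t)) (simpleRoot s) = -2 * Real.cos (Real.pi / m) := by
    simp [rootForm_simpleRoot, M.symmetric t s, ← hm, h0]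
  have hmpos : (0 : ℝ) < m := by exact_mod_cast Nat.pos_of_ne_zero h0
  have ht : (2 * Real.cos (2 * (Real.pi / m)) : ℝ) =
      ((2 : ℝ) • rootForm M (simpleRoot s)) (simpleRoot t) *
        ((2 : ℝ) • rootForm M (simpleRoot t)) (simpleRoot s) - 2 := by
    rw [hx, hy, Real.cos_two_mul]; ring
  ext1 z
  rw [simpleReflection, simpleReflection,
    Module.reflection_mul_reflection_pow_apply (two_rootForm_self M s) (two_rootForm_self M t)
      m z _ ht, hx, hy]
  obtain h2 | h3 : m = 2 ∨ 3 ≤ m := by omega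
  · have e1 : (((2 : ℕ) : ℤ) - 2) / 2 = 0 := by norm_num
    have e2 : (((2 : ℕ) : ℤ) - 1) / 2 = 0 := by norm_num
    have e3 : (((2 : ℕ) : ℤ) - 3) / 2 = -1 := by norm_num
    have e4 : (((2 : ℕ) : ℤ)) / 2 = 1 := by norm_num
    rw [h2, e1, e2, e3, e4]
    have e5 : Real.cos (2 * (Real.pi / ((2 : ℕ) : ℝ))) = -1 := by
      rw [show 2 * (Real.pi / ((2 : ℕ) : ℝ)) = Real.pi by push_cast; ring, Real.cos_pi]
    have e6 : Real.cos (Real.pi / ((2 : ℕ) : ℝ)) = 0 := by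
      push_cast; exact Real.cos_pi_div_two
    rw [e5, e6]
    simp only [S_zero, S_one, S_neg_one, Polynomial.eval_one, Polynomial.eval_X,
      Polynomial.eval_zero, LinearEquiv.coe_one, id_eq]
    module
  · set θ : ℝ := 2 * (Real.pi / m) with hθ
    have hsin : Real.sin θ ≠ 0 := by
      apply ne_of_gt
      apply Real.sin_pos_of_pos_of_lt_pi
      · positivity
      · have : (3 : ℝ) ≤ m := by exact_mod_cast h3
        rw [hθ, ← mul_div_assoc, div_lt_iff₀ hmpos]
        nlinarith [Real.pi_pos]
    have key (k : ℤ) : (S ℝ k).eval (2 * Real.cos θ) = Real.sin ((k + 1) * θ) / Real.sin θ := by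
      rw [eq_div_iff hsin, S_two_mul_real_cos]
    have hmθ : (m : ℝ) * θ = 2 * Real.pi := by
      rw [hθ]; field_simp
    obtain ⟨k, hk | hk⟩ := Nat.even_or_odd' m
    · have e1 : ((m : ℤ) - 2) / 2 = k - 1 := by omega
      have e2 : ((m : ℤ) - 1) / 2 = k - 1 := by omega
      have hz : (S ℝ ((k : ℤ) - 1)).eval (2 * Real.cos θ) = 0 := by
        rw [key]
        have : (((k : ℤ) - 1 : ℤ) + 1 : ℝ) * θ = Real.pi := by
          have : (m : ℝ) = 2 * k := by exact_mod_cast hk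
          rw [this] at hmθ
          push_cast
          linarith
        rw [this, Real.sin_pi, zero_div]
      rw [e1, e2, hz]
      simp
    · have e1 : ((m : ℤ) - 2) / 2 = k - 1 := by omega
      have e2 : ((m : ℤ) - 1) / 2 = k := by omega
      have e3 : ((m : ℤ) - 3) / 2 = k - 1 := by omega
      have e4 : (m : ℤ) / 2 = k := by omega
      have hz : (S ℝ (k : ℤ)).eval (2 * Real.cos θ) +
          (S ℝ ((k : ℤ) - 1)).eval (2 * Real.cos θ) = 0 := by
        rw [key, key, ← add_div]
        have : ((k : ℤ) + 1 : ℝ) * θ = 2 * Real.pi - (((k : ℤ) - 1 : ℤ) + 1 : ℝ) * θ := by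
          have : (m : ℝ) = 2 * k + 1 := by exact_mod_cast hk
          rw [this] at hmθ
          push_cast
          linarith
        rw [this, Real.sin_two_pi_sub]
        simp
      rw [e1, e2, e3, e4, hz]
      simp

variable {M : CoxeterMatrix B} {W : Type*} [Group W] (cs : CoxeterSystem M W)

/-- The action of `W` on `V`, determined by `s v = v - 2 (r_s, v) r_s` for simple `s`. -/
noncomputable def rootAction : W →* ((B → ℝ) ≃ₗ[ℝ] (B → ℝ)) :=
  cs.lift ⟨simpleReflection M, simpleReflection_isLiftable M⟩

/-- The root system: all vectors `w r_s`. -/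
def rootSet : Set (B → ℝ) := {r | ∃ (w : W) (s : B), r = rootAction cs w (simpleRoot s)}

/-- The positive roots. -/
def positiveRoots : Set (B → ℝ) := {r | r ∈ rootSet cs ∧ ∀ s, 0 ≤ r s}

/-- The negative roots. -/
def negativeRoots : Set (B → ℝ) := {r | r ∈ rootSet cs ∧ ∀ s, r s ≤ 0}

/-- `R(w)`, the set of inversions of `w⁻¹`. -/
def inversionSet (w : W) : Set (B → ℝ) :=
  {r | r ∈ positiveRoots cs ∧ rootAction cs w⁻¹ r ∈ negativeRoots cs}

theorem inversionSet_one_isEmpty : IsEmpty (inversionSet cs 1) := by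
  refine ⟨?_⟩
  rintro ⟨r, ⟨⟨w, s, hr⟩, hpos⟩, ⟨_, hneg⟩⟩
  have h0 : r = 0 := by
    funext t
    refine le_antisymm ?_ (hpos t)
    simpa using hneg t
  have : simpleRoot s = 0 := by
    rw [h0] at hr
    exact ((rootAction cs w).map_eq_zero_iff).1 hr.symm
  simpa [simpleRoot] using congrFun this s

/-! ### The functions `Φ(λ, s)` and the sets `C(w)` -/

open Classical in
/-- The function `Φ(λ, s) : R(ws) → ℕ₊`. It extends `λ : R(w) → ℕ₊`; at a root `r ∉ R(w)` it is `1`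
if `r` is simple and no `r' ∈ R(w)` has `(r, r') > 0`, and otherwise it is `λ(r') + 1`, where `λ(r')`
is maximal among the `r' ∈ R(w)` with `(r, r') > 0`. -/
noncomputable def extendFun (w : W) (s : B) (lam : inversionSet cs w → ℕ+) :
    inversionSet cs (w * cs.simple s) → ℕ+ := fun r =>
  if h : (r : B → ℝ) ∈ inversionSet cs w then lam ⟨r, h⟩
  else if (∃ t : B, (r : B → ℝ) = simpleRoot t) ∧
      ∀ r' : inversionSet cs w, ¬ 0 < rootForm M (r : B → ℝ) (r' : B → ℝ) then 1
  else Nat.succPNat (sSup {n : ℕ | ∃ r' : inversionSet cs w,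
      0 < rootForm M (r : B → ℝ) (r' : B → ℝ) ∧ n = lam r'})

/-- `IsC cs w λ` says that `λ ∈ C(w)`: `C(1)` consists of the empty function, and `C(w)` for
`w ≠ 1` consists of the functions `Φ(λ, s)` for right descents `s` of `w` and `λ ∈ C(ws)`.
The second rule is stated for `ws` in place of `w`: `s` is a right descent of `ws` exactly
if it is not one of `w`. -/
inductive IsC : (w : W) → (inversionSet cs w → ℕ+) → Prop
  | one : IsC 1 (fun r => (inversionSet_one_isEmpty cs).elim r)
  | step (w : W) (s : B) (hs : ¬ cs.IsRightDescent w s) (lam : inversionSet cs w → ℕ+)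
      (hlam : IsC w lam) : IsC (w * cs.simple s) (extendFun cs w s lam)

/-- The set `C(w)`. -/
def C (w : W) : Set (inversionSet cs w → ℕ+) := {lam | IsC cs w lam}

/-! ### Reduced word posets and their depth functions -/

/-- The map `φ_ω : P(ω) → V`, sending a position `i` to `ω₁ ⋯ ω_{i-1} r_{ω_i}`. -/
noncomputable def wordRoot (ω : List B) (i : WordIndex cs.simple ω) : B → ℝ :=
  rootAction cs (cs.wordProd (ω.take i.pos)) (simpleRoot i.letter)

/-- `P` is a reduced word poset for `w`: it is the word poset of a commutation class of reduced
words for `w`. -/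
def IsReducedWordPoset (w : W) (P : WordPoset.{v} cs.simple) : Prop :=
  ∃ ω : List B, cs.IsReduced ω ∧ cs.wordProd ω = w ∧
    Nonempty (P.Iso (WordPoset.ofWord cs.simple ω))

/-- The map `φ_P : P → V` of a reduced word poset, read off from some identification of
`P` with `P(ω)`. -/
noncomputable def posetRoot {w : W} {P : WordPoset.{v} cs.simple} (hP : IsReducedWordPoset cs w P)
    (p : P.carrier) : B → ℝ :=
  wordRoot cs hP.choose (hP.choose_spec.2.2.some.toOrderIso p)

open Classical in
/-- The function `λ_P : R(w) → ℕ₊`, `λ_P(r) = dp(φ_P⁻¹(r))`. (The value `1` off the range of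
`φ_P` is never used, as `φ_P` is a bijection onto `R(w)`.) -/
noncomputable def depthFunction {w : W} {P : WordPoset.{v} cs.simple}
    (hP : IsReducedWordPoset cs w P) (r : inversionSet cs w) : ℕ+ :=
  if h : ∃ p : P.carrier, posetRoot cs hP p = r then depth h.choose else 1

end Roots

/-!
Two independent facts carry the proof.

*Inversions.* By `rootAction_simpleRoot_nonneg`, `w r_s` is positive whenever `ℓ(ws) > ℓ(w)`; this is
reduced to the dihedral group generated by `s` and a right descent of `w`, where the coordinates of
the roots are the numbers `sin (k π / m) / sin (π / m)`. Consequently every root is positive or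
negative, and `R(ws) = R(w) ∪ {w r_s}` (`inversionSet_mul_simple`). So the vectors attached to the
positions of a reduced word for `w` run through `R(w)` without repetition (`listRoot_bijOn`).

*Linear extensions.* An identification of a word poset `P` with the poset of a word is a linear
extension of `P`. Two linear extensions differ by exchanging commuting letters, which does not affect
the roots attached to the elements of `P` (`IsLinearExtension.listRoot_eq`), so `φ_P` is well defined.
Moreover, roots can be computed in whichever extension is convenient. If `i` and `j` are
incomparable, or `j` covers `i`, then some extension lists `j` right after `i`, and the form on the
two roots is then minus the form on the simple roots of the labels. Hence roots of incomparable
elements are orthogonal, and the roots along a covering relation form an acute angle; the root of a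
minimal element is simple.

Now let a letter `s` be appended to a reduced word, and let `r` be the root of the new, maximal
position `m`. The positions whose roots form an acute angle with `r` lie below `m` and include all
those covered by `m`, among which there is one of depth `dp(m) - 1` unless `m` is minimal. So the rule
that defines `Φ(λ, s)` computes exactly the depth of `m` (`IsWordDepth.extendFun`), and `C(w)` is the
set of depth functions of reduced words for `w` (`isC_iff`).
-/

/-! ### Reduced words in two letters -/

section ReducedWords

variable {B : Type*} {M : CoxeterMatrix B} {W : Type*} [Group W] (cs : CoxeterSystem M W)

theorem CoxeterMatrix.two_le_of_ne (M : CoxeterMatrix B) {s t : B} (h : s ≠ t)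
    (h0 : M s t ≠ 0) : 2 ≤ M s t := by
  have := M.off_diagonal s t h
  omega

theorem CoxeterSystem.IsReduced.of_append_left {ω ω' : List B} (h : cs.IsReduced (ω ++ ω')) :
    cs.IsReduced ω := by
  simpa using h.take ω.length

theorem CoxeterSystem.IsReduced.of_append_right {ω ω' : List B} (h : cs.IsReduced (ω ++ ω')) :
    cs.IsReduced ω' := by
  simpa using h.drop ω.length

theorem CoxeterSystem.not_isReduced_pair (s : B) : ¬ cs.IsReduced [s, s] := by
  simp [CoxeterSystem.IsReduced, CoxeterSystem.wordProd]

theorem CoxeterSystem.IsReduced.not_isRightDescent {ω : List B} {s : B}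
    (h : cs.IsReduced (ω ++ [s])) : ¬ cs.IsRightDescent (cs.wordProd ω) s := by
  have h1 := h.eq
  have h2 := (CoxeterSystem.IsReduced.of_append_left cs h).eq
  rw [cs.wordProd_append, cs.wordProd_singleton] at h1
  rw [cs.not_isRightDescent_iff, h1, h2]
  simp

theorem CoxeterSystem.IsReduced.append_singleton {ω : List B} {s : B} (h : cs.IsReduced ω)
    (hs : ¬ cs.IsRightDescent (cs.wordProd ω) s) : cs.IsReduced (ω ++ [s]) := by
  rw [cs.not_isRightDescent_iff, h.eq] at hs
  rw [CoxeterSystem.IsReduced, cs.wordProd_append, cs.wordProd_singleton, hs]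
  simp

/-- A reduced word in the letters `s` and `t` alternates; requiring that it stays reduced when `s`
is appended makes `t` its last letter. -/
theorem eq_alternatingWord (l : List B) : ∀ {s t : B}, (∀ x ∈ l, x = s ∨ x = t) →
    cs.IsReduced (l ++ [s]) → l = CoxeterSystem.alternatingWord s t l.length := by
  induction l using List.reverseRecOn with
  | nil => intros; rfl
  | append_singleton l x ih =>
    intro s t hl hr
    have hx : x = t := by
      rcases hl x (by simp) with rfl | rfl
      · rw [List.append_assoc] at hr
        exact absurd (CoxeterSystem.IsReduced.of_append_right cs hr) (cs.not_isReduced_pair x)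
      · rfl
    subst hx
    have h1 := ih (s := x) (t := s) (fun y hy => (hl y (by simp [hy])).symm)
      (CoxeterSystem.IsReduced.of_append_left cs hr)
    rw [List.length_append, List.length_singleton, CoxeterSystem.alternatingWord_succ, ← h1,
      List.concat_eq_append]

end ReducedWords

/-! ### The root system and its form -/

theorem simpleRoot_nonneg {B : Type*} [DecidableEq B] (s b : B) : 0 ≤ simpleRoot s b := by
  by_cases h : b = s
  · subst h; simp [simpleRoot]
  · simp [simpleRoot, h]

section RootSystem

variable {B : Type*} [Fintype B] [DecidableEq B] {M : CoxeterMatrix B}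
  {W : Type*} [Group W] (cs : CoxeterSystem M W)

theorem rootForm_comm (M : CoxeterMatrix B) (u v : B → ℝ) : rootForm M u v = rootForm M v u := by
  have h : (rootForm M).flip = rootForm M := by
    refine LinearMap.ext_basis (Pi.basisFun ℝ B) (Pi.basisFun ℝ B) fun s t => ?_
    rw [Pi.basisFun_apply, Pi.basisFun_apply]
    change rootForm M (simpleRoot t) (simpleRoot s) = rootForm M (simpleRoot s) (simpleRoot t)
    rw [rootForm_simpleRoot, rootForm_simpleRoot, M.symmetric t s]
  exact (LinearMap.congr_fun₂ h v u)

theorem rootForm_simpleRoot_self (s : B) : rootForm M (simpleRoot s) (simpleRoot s) = 1 := by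
  simp [rootForm_simpleRoot]

theorem rootForm_simpleRoot_nonpos {s t : B} (h : s ≠ t) :
    rootForm M (simpleRoot s) (simpleRoot t) ≤ 0 := by
  rw [rootForm_simpleRoot]
  split_ifs with h0
  · norm_num
  · have h2 : (2 : ℝ) ≤ M s t := by exact_mod_cast M.two_le_of_ne h h0
    rw [neg_nonpos]
    apply Real.cos_nonneg_of_neg_pi_div_two_le_of_le
    · have : 0 ≤ Real.pi / M s t := by positivity
      linarith [Real.pi_pos]
    · gcongr

theorem rootAction_simple (s : B) (v : B → ℝ) :
    rootAction cs (cs.simple s) v = v - (2 * rootForm M (simpleRoot s) v) • simpleRoot s := by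
  rw [rootAction, cs.lift_apply_simple, simpleReflection_apply]

theorem rootAction_mul (x y : W) (v : B → ℝ) :
    rootAction cs (x * y) v = rootAction cs x (rootAction cs y v) := by
  simp [LinearEquiv.mul_apply]

theorem rootAction_inv_apply (x : W) (v : B → ℝ) :
    rootAction cs x⁻¹ (rootAction cs x v) = v := by
  rw [← rootAction_mul]; simp

theorem rootAction_apply_inv (x : W) (v : B → ℝ) :
    rootAction cs x (rootAction cs x⁻¹ v) = v := by
  rw [← rootAction_mul]; simp

theorem rootAction_simple_self (s : B) :
    rootAction cs (cs.simple s) (simpleRoot s) = -simpleRoot s := by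
  rw [rootAction_simple, rootForm_simpleRoot_self]
  module

theorem rootAction_simple_of_rootForm_eq_zero {s : B} {v : B → ℝ}
    (h : rootForm M (simpleRoot s) v = 0) : rootAction cs (cs.simple s) v = v := by
  rw [rootAction_simple, h]
  module

theorem rootForm_rootAction (w : W) (u v : B → ℝ) :
    rootForm M (rootAction cs w u) (rootAction cs w v) = rootForm M u v := by
  induction w using cs.simple_induction_left with
  | one => simp
  | mul_simple_left w s ih =>
    rw [rootAction_mul, rootAction_mul, ← ih, rootAction_simple, rootAction_simple]
    simp only [map_sub, map_smul, LinearMap.sub_apply, LinearMap.smul_apply, smul_eq_mul,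
      rootForm_simpleRoot_self, rootForm_comm M _ (simpleRoot s)]
    ring

/-- Commutation of simple reflections is visible in the form: `s t = t s` forces the simple roots
to be orthogonal, as one sees by letting both sides act on `r_t`. -/
theorem commute_simple_iff {s t : B} (h : s ≠ t) :
    Commute (cs.simple s) (cs.simple t) ↔ rootForm M (simpleRoot s) (simpleRoot t) = 0 := by
  constructor
  · intro hc
    have h1 := congrArg (fun x => rootAction cs x (simpleRoot t) s) hc.eq
    simp only [rootAction_mul, rootAction_simple] at h1
    simp only [map_sub, map_smul, rootForm_simpleRoot_self,
      rootForm_comm M (simpleRoot t) (simpleRoot s), smul_eq_mul] at h1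
    have e1 : simpleRoot s s = 1 := by simp [simpleRoot]
    have e2 : simpleRoot t s = 0 := by simp [simpleRoot, h]
    simp only [Pi.sub_apply, Pi.smul_apply, smul_eq_mul, e1, e2] at h1
    linarith
  · intro h0
    have h2 : M s t = 2 := by
      rw [rootForm_simpleRoot] at h0
      split_ifs at h0 with hm
      · norm_num at h0
      · have h2 := M.two_le_of_ne h hm
        by_contra hne
        have h3 : (3 : ℝ) ≤ M s t := by
          have : 3 ≤ M s t := by omega
          exact_mod_cast this
        have hlt : Real.pi / M s t < Real.pi / 2 :=
          div_lt_div_of_pos_left Real.pi_pos (by norm_num) (by linarith)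
        have : 0 < Real.cos (Real.pi / M s t) := by
          apply Real.cos_pos_of_mem_Ioo
          constructor
          · have : 0 ≤ Real.pi / M s t := by positivity
            linarith [Real.pi_pos]
          · exact hlt
        linarith
    have h3 := cs.simple_mul_simple_pow s t
    rw [h2, pow_two] at h3
    have h4 := eq_inv_of_mul_eq_one_left h3
    rwa [mul_inv_rev, cs.inv_simple, cs.inv_simple] at h4

/-! ### Positivity of roots -/

/-- The coefficients `sin (k θ) / sin θ`, `θ = π / m`, of the roots of a dihedral group: they solve
the recursion of the Chebyshev polynomials, and are nonnegative up to `k = m`. For `m = ∞`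
(encoded by `0`) they degenerate to `k`. -/
theorem exists_dihedral_coeff {s t : B} (h : s ≠ t) : ∃ p : ℕ → ℝ, p 0 = 0 ∧ p 1 = 1 ∧
    (∀ k, p (k + 2) = -2 * rootForm M (simpleRoot s) (simpleRoot t) * p (k + 1) - p k) ∧
    ∀ k, (M s t = 0 ∨ k ≤ M s t) → 0 ≤ p k := by
  simp only [rootForm_simpleRoot]
  split_ifs with h0
  · refine ⟨fun k => k, by simp, by simp, fun k => ?_, fun k _ => by positivity⟩
    push_cast
    ring
  · have h2 : (2 : ℝ) ≤ M s t := by exact_mod_cast M.two_le_of_ne h h0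
    set θ := Real.pi / M s t with hθ
    have hsin : 0 < Real.sin θ := by
      apply Real.sin_pos_of_pos_of_lt_pi
      · have := Real.pi_pos
        positivity
      · rw [hθ, div_lt_iff₀ (by linarith)]
        nlinarith [Real.pi_pos]
    refine ⟨fun k => Real.sin (k * θ) / Real.sin θ, by simp, ?_, fun k => ?_, fun k hk => ?_⟩
    · simp [hsin.ne']
    · have e1 : ((k + 2 : ℕ) : ℝ) * θ = ((k + 1 : ℕ) : ℝ) * θ + θ := by push_cast; ring
      have e2 : (k : ℝ) * θ = ((k + 1 : ℕ) : ℝ) * θ - θ := by push_cast; ring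
      simp only
      rw [e1, e2, Real.sin_add, Real.sin_sub]
      field_simp
      ring
    · have hk' : (k : ℝ) ≤ M s t := by exact_mod_cast hk.resolve_left h0
      apply div_nonneg _ hsin.le
      apply Real.sin_nonneg_of_nonneg_of_le_pi
      · have := Real.pi_pos
        positivity
      · rw [hθ, ← mul_div_assoc, div_le_iff₀ (by linarith), mul_comm]
        gcongr

theorem rootAction_alternatingWord {s t : B} {p : ℕ → ℝ} (p0 : p 0 = 0) (p1 : p 1 = 1)
    (hp : ∀ k, p (k + 2) = -2 * rootForm M (simpleRoot s) (simpleRoot t) * p (k + 1) - p k)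
    (k : ℕ) :
    rootAction cs (cs.wordProd (CoxeterSystem.alternatingWord s t k)) (simpleRoot s) =
      if Even k then p (k + 1) • simpleRoot s + p k • simpleRoot t
      else p (k + 1) • simpleRoot t + p k • simpleRoot s := by
  induction k with
  | zero => simp [CoxeterSystem.alternatingWord, p0, p1]
  | succ k ih =>
    rw [CoxeterSystem.alternatingWord_succ', cs.wordProd_cons, rootAction_mul, ih]
    by_cases hk : Even k
    · have hk' : ¬ Even (k + 1) := by simp [hk, parity_simps]
      rw [if_pos hk, if_pos hk, if_neg hk', rootAction_simple, hp]
      simp only [map_add, map_smul, rootForm_simpleRoot_self, smul_eq_mul,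
        rootForm_comm M (simpleRoot t) (simpleRoot s)]
      module
    · have hk' : Even (k + 1) := by simp [hk, parity_simps]
      rw [if_neg hk, if_neg hk, if_pos hk', rootAction_simple, hp]
      simp only [map_add, map_smul, rootForm_simpleRoot_self, smul_eq_mul]
      module

/-- If `ℓ(ws) > ℓ(w)`, then `w r_s` is positive. With `t` a right descent of `w`, split off from `w`
the longest possible right factor in the dihedral group of `s` and `t`: the remaining factor `v`
has neither `s` nor `t` as a descent, so that `v r_s` and `v r_t` are positive by induction, and the
dihedral factor maps `r_s` to a nonnegative combination of `r_s` and `r_t`. -/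
theorem rootAction_simpleRoot_nonneg (w : W) (s : B) (hs : ¬ cs.IsRightDescent w s) (b : B) :
    0 ≤ rootAction cs w (simpleRoot s) b := by
  induction hn : cs.length w using Nat.strong_induction_on generalizing w s with
  | _ n ih =>
  by_cases hw : w = 1
  · subst hw
    simpa using simpleRoot_nonneg s b
  obtain ⟨t, ht⟩ := cs.exists_rightDescent_of_ne_one hw
  have hst : s ≠ t := by
    rintro rfl
    exact hs ht
  classical
  have hex : ∃ k v, cs.length v = k ∧ ∃ l : List B, (∀ x ∈ l, x = s ∨ x = t) ∧
      w = v * cs.wordProd l ∧ cs.length w = cs.length v + l.length := by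
    refine ⟨_, w * cs.simple t, rfl, [t], by simp, by simp, ?_⟩
    rw [cs.isRightDescent_iff] at ht
    simp [ht]
  obtain ⟨v, hv, l, hl, hwl, hlen⟩ := Nat.find_spec hex
  -- `v` has minimal length among the left factors that leave a word in `s` and `t`.
  have hmin := fun k => Nat.find_min hex (m := k)
  rw [← hv] at hmin
  have hvw : cs.length v < cs.length w := by
    have := cs.isRightDescent_iff.1 ht
    by_contra hcon
    refine hmin (cs.length (w * cs.simple t)) (by omega) ⟨_, rfl, [t], by simp, by simp, ?_⟩
    simp [this]
  have hdesc : ∀ a, (a = s ∨ a = t) → ¬ cs.IsRightDescent v a := by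
    intro a ha hd
    have h1 := cs.isRightDescent_iff.1 hd
    refine hmin (cs.length (v * cs.simple a)) (by omega) ⟨_, rfl, a :: l, ?_, ?_, ?_⟩
    · simpa [ha] using hl
    · rw [cs.wordProd_cons, ← mul_assoc, cs.simple_mul_simple_cancel_right, hwl]
    · rw [List.length_cons]
      omega
  have hred : cs.IsReduced (l ++ [s]) := by
    have h1 := cs.not_isRightDescent_iff.1 hs
    have h2 := cs.length_mul_le v (cs.wordProd (l ++ [s]))
    have h3 := cs.length_wordProd_le (l ++ [s])
    rw [cs.wordProd_append, ← mul_assoc, ← hwl, cs.wordProd_singleton, h1] at h2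
    rw [cs.wordProd_append, cs.wordProd_singleton] at h3
    rw [CoxeterSystem.IsReduced, cs.wordProd_append, cs.wordProd_singleton]
    simp only [List.length_append, List.length_singleton] at h3 ⊢
    omega
  have halt := eq_alternatingWord cs l hl hred
  -- `l` alternates and can be prolonged by `s` to a reduced word, so it is shorter than `m`.
  have hk : M s t = 0 ∨ l.length + 1 ≤ M s t := by
    by_contra! hcon
    have hM : M t s = M s t := M.symmetric t s
    refine cs.not_isReduced_alternatingWord t s (m := l.length + 1) (by rw [hM]; exact hcon.1)
      (by rw [hM]; exact hcon.2) ?_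
    rw [CoxeterSystem.alternatingWord_succ, ← halt, List.concat_eq_append]
    exact hred
  obtain ⟨p, p0, p1, hp, hpos⟩ := exists_dihedral_coeff (M := M) hst
  have hps : 0 ≤ p (l.length + 1) := hpos _ hk
  have hpt : 0 ≤ p l.length := hpos _ (hk.imp_right fun h => by omega)
  have hvs := ih _ (hn ▸ hvw) v s (hdesc s (Or.inl rfl)) rfl
  have hvt := ih _ (hn ▸ hvw) v t (hdesc t (Or.inr rfl)) rfl
  rw [hwl, rootAction_mul, halt, rootAction_alternatingWord cs p0 p1 hp]
  split_ifs <;> simp only [map_add, map_smul, Pi.add_apply, Pi.smul_apply, smul_eq_mul] <;>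
    positivity

theorem neg_mem_rootSet {r : B → ℝ} (h : r ∈ rootSet cs) : -r ∈ rootSet cs := by
  obtain ⟨w, s, rfl⟩ := h
  exact ⟨w * cs.simple s, s, by rw [rootAction_mul, rootAction_simple_self, map_neg]⟩

theorem rootAction_mem_rootSet (x : W) {r : B → ℝ} (h : r ∈ rootSet cs) :
    rootAction cs x r ∈ rootSet cs := by
  obtain ⟨w, s, rfl⟩ := h
  exact ⟨x * w, s, by rw [rootAction_mul]⟩

theorem simpleRoot_mem_rootSet (s : B) : simpleRoot s ∈ rootSet cs := ⟨1, s, by simp⟩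

theorem simpleRoot_mem_positiveRoots (s : B) : simpleRoot s ∈ positiveRoots cs :=
  ⟨simpleRoot_mem_rootSet cs s, simpleRoot_nonneg s⟩

theorem rootForm_self_of_mem_rootSet {r : B → ℝ} (h : r ∈ rootSet cs) : rootForm M r r = 1 := by
  obtain ⟨w, s, rfl⟩ := h
  rw [rootForm_rootAction, rootForm_simpleRoot_self]

theorem neg_mem_negativeRoots_iff {r : B → ℝ} : -r ∈ negativeRoots cs ↔ r ∈ positiveRoots cs := by
  constructor
  · rintro ⟨h1, h2⟩
    exact ⟨by simpa using neg_mem_rootSet cs h1, fun b => by simpa using h2 b⟩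
  · rintro ⟨h1, h2⟩
    exact ⟨neg_mem_rootSet cs h1, fun b => by simpa using h2 b⟩

theorem mem_positiveRoots_or_mem_negativeRoots {r : B → ℝ} (h : r ∈ rootSet cs) :
    r ∈ positiveRoots cs ∨ r ∈ negativeRoots cs := by
  obtain ⟨w, s, rfl⟩ := h
  by_cases hs : cs.IsRightDescent w s
  · right
    refine ⟨⟨w, s, rfl⟩, fun b => ?_⟩
    have h1 := rootAction_simpleRoot_nonneg cs (w * cs.simple s) s
      (cs.isRightDescent_iff_not_isRightDescent_mul.1 hs) b
    rw [rootAction_mul, rootAction_simple_self, map_neg] at h1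
    simpa using h1
  · exact Or.inl ⟨⟨w, s, rfl⟩, rootAction_simpleRoot_nonneg cs w s hs⟩

theorem notMem_negativeRoots_of_mem_positiveRoots {r : B → ℝ} (h : r ∈ positiveRoots cs) :
    r ∉ negativeRoots cs := fun h' => by
  have h0 : r = 0 := funext fun b => le_antisymm (h'.2 b) (h.2 b)
  have h1 := rootForm_self_of_mem_rootSet cs h.1
  simp [h0] at h1

/-- The reflection `s` permutes the positive roots other than `r_s`: such a root has a positive
coordinate away from `s`, which the reflection does not change. -/
theorem rootAction_simple_mem_positiveRoots {s : B} {r : B → ℝ} (h : r ∈ positiveRoots cs)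
    (hne : r ≠ simpleRoot s) : rootAction cs (cs.simple s) r ∈ positiveRoots cs := by
  have hroot := rootAction_mem_rootSet cs (cs.simple s) h.1
  refine (mem_positiveRoots_or_mem_negativeRoots cs hroot).resolve_right fun hneg => hne ?_
  have hz : ∀ b, b ≠ s → r b = 0 := fun b hb => by
    have h1 := hneg.2 b
    rw [rootAction_simple] at h1
    have h2 : simpleRoot s b = 0 := by simp [simpleRoot, hb]
    simp only [Pi.sub_apply, Pi.smul_apply, h2, smul_zero, sub_zero] at h1
    exact le_antisymm h1 (h.2 b)
  have hr : r = r s • simpleRoot s := by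
    funext b
    by_cases hb : b = s
    · subst hb; simp [simpleRoot]
    · simp [simpleRoot, hb, hz b hb]
  have h1 := rootForm_self_of_mem_rootSet cs h.1
  rw [hr] at h1
  simp only [map_smul, LinearMap.smul_apply, smul_eq_mul, rootForm_simpleRoot_self] at h1
  have h2 : r s = 1 := by nlinarith [h.2 s]
  rw [hr, h2, one_smul]

theorem rootAction_simpleRoot_notMem_inversionSet (w : W) (s : B) :
    rootAction cs w (simpleRoot s) ∉ inversionSet cs w := fun h => by
  have h1 := h.2
  rw [rootAction_inv_apply] at h1
  exact notMem_negativeRoots_of_mem_positiveRoots cs (simpleRoot_mem_positiveRoots cs s) h1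

theorem inversionSet_mul_simple {w : W} {s : B} (hs : ¬ cs.IsRightDescent w s) :
    inversionSet cs (w * cs.simple s) =
      insert (rootAction cs w (simpleRoot s)) (inversionSet cs w) := by
  ext r
  simp only [inversionSet, Set.mem_insert_iff, Set.mem_ofPred_eq, mul_inv_rev, cs.inv_simple,
    rootAction_mul]
  have hpos : rootAction cs w (simpleRoot s) ∈ positiveRoots cs :=
    ⟨⟨w, s, rfl⟩, rootAction_simpleRoot_nonneg cs w s hs⟩
  constructor
  · rintro ⟨h1, h2⟩
    have hroot := rootAction_mem_rootSet cs w⁻¹ h1.1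
    rcases mem_positiveRoots_or_mem_negativeRoots cs hroot with h3 | h3
    · left
      by_contra hne
      refine notMem_negativeRoots_of_mem_positiveRoots cs
        (rootAction_simple_mem_positiveRoots cs (s := s) h3 fun h4 => hne ?_) h2
      rw [← h4, rootAction_apply_inv]
    · exact Or.inr ⟨h1, h3⟩
  · rintro (rfl | ⟨h1, h2⟩)
    · refine ⟨hpos, ?_⟩
      rw [rootAction_inv_apply, rootAction_simple_self, neg_mem_negativeRoots_iff]
      exact simpleRoot_mem_positiveRoots cs s
    · refine ⟨h1, ?_⟩
      have h3 : -rootAction cs w⁻¹ r ∈ positiveRoots cs := by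
        rw [← neg_mem_negativeRoots_iff, neg_neg]
        exact h2
      have h4 := rootAction_simple_mem_positiveRoots cs (s := s) h3 fun h5 => by
        have h6 : r = -rootAction cs w (simpleRoot s) := by
          rw [← h5, map_neg, rootAction_apply_inv, neg_neg]
        refine notMem_negativeRoots_of_mem_positiveRoots cs h1 ?_
        rw [h6, neg_mem_negativeRoots_iff]
        exact hpos
      rwa [map_neg, ← neg_mem_negativeRoots_iff, neg_neg] at h4

end RootSystem

/-! ### Linear extensions of finite posets -/

section LinearExtensions

variable {α : Type*} [PartialOrder α]

/-- A linear extension of a finite poset, as a list of its elements in which no element precedes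
a smaller one. -/
structure IsLinearExtension (l : List α) : Prop where
  nodup : l.Nodup
  mem : ∀ a, a ∈ l
  pairwise : l.Pairwise fun a b => ¬ b < a

theorem exists_sorted_list_of_finset (s : Finset α) :
    ∃ l : List α, l.Nodup ∧ (∀ a, a ∈ l ↔ a ∈ s) ∧ l.Pairwise fun a b => ¬ b < a := by
  classical
  induction s using Finset.strongInduction with
  | H s ih =>
  rcases s.eq_empty_or_nonempty with rfl | hs
  · exact ⟨[], by simp⟩
  · obtain ⟨m, hm⟩ := s.exists_maximal hs
    obtain ⟨l, h1, h2, h3⟩ := ih _ (Finset.erase_ssubset hm.prop)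
    refine ⟨l ++ [m], ?_, fun a => ?_, ?_⟩
    · rw [List.nodup_append]
      refine ⟨h1, by simp, fun a ha b hb => ?_⟩
      rw [List.mem_singleton.1 hb]
      exact (Finset.mem_erase.1 ((h2 a).1 ha)).1
    · rw [List.mem_append, h2, Finset.mem_erase, List.mem_singleton]
      by_cases h : a = m
      · simp [h, hm.prop]
      · simp [h]
    · rw [List.pairwise_append]
      refine ⟨h3, by simp, fun a ha b hb hlt => ?_⟩
      rw [List.mem_singleton.1 hb] at hlt
      exact hm.not_gt (Finset.mem_erase.1 ((h2 a).1 ha)).2 hlt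

/-- If no element lies strictly between `i` and `j`, and `j` is not below `i`, then `j` directly
follows `i` in some linear extension: list first the remaining elements below `i` or `j`. -/
theorem exists_isLinearExtension_adjacent [Finite α] {i j : α} (hne : i ≠ j) (hji : ¬ j < i)
    (hbtw : ∀ c, i < c → ¬ c < j) : ∃ x y : List α, IsLinearExtension (x ++ i :: j :: y) := by
  classical
  have := Fintype.ofFinite α
  obtain ⟨x, x1, x2, x3⟩ := exists_sorted_list_of_finset
    (Finset.univ.filter fun c : α => (c < i ∨ c < j) ∧ c ≠ i)
  obtain ⟨y, y1, y2, y3⟩ := exists_sorted_list_of_finset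
    (Finset.univ.filter fun c : α => ¬ (c < i ∨ c < j) ∧ c ≠ i ∧ c ≠ j)
  simp only [Finset.mem_filter, Finset.mem_univ, true_and] at x2 y2
  refine ⟨x, y, ?_, fun a => ?_, ?_⟩
  · simp only [List.nodup_append, List.nodup_cons, List.mem_cons, x2, y2]
    refine ⟨x1, ⟨by tauto, by tauto, y1⟩, ?_⟩
    rintro a ⟨ha, hai⟩ b (rfl | rfl | ⟨hb, -, -⟩) rfl
    · exact hai rfl
    · exact ha.elim hji (lt_irrefl _)
    · exact hb ha
  · simp only [List.mem_append, List.mem_cons, x2, y2]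
    tauto
  · simp only [List.pairwise_append, List.pairwise_cons, List.mem_cons, x2, y2]
    refine ⟨x3, ⟨?_, ?_, y3⟩, ?_⟩
    · rintro b (rfl | ⟨hb, -, -⟩) hlt
      · exact hji hlt
      · exact hb (Or.inl hlt)
    · rintro b ⟨hb, -, -⟩ hlt
      exact hb (Or.inr hlt)
    · rintro a ⟨ha | ha, hai⟩ b (rfl | rfl | ⟨hb, hb1, hb2⟩) hlt
      · exact lt_asymm ha hlt
      · exact hji (hlt.trans ha)
      · exact hb (Or.inl (hlt.trans ha))
      · exact hbtw a hlt ha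
      · exact lt_asymm ha hlt
      · exact hb (Or.inr (hlt.trans ha))

theorem exists_isLinearExtension_cons [Finite α] {i : α} (hi : IsMin i) :
    ∃ y : List α, IsLinearExtension (i :: y) := by
  classical
  have := Fintype.ofFinite α
  obtain ⟨y, y1, y2, y3⟩ := exists_sorted_list_of_finset (Finset.univ.erase i)
  simp only [Finset.mem_erase, Finset.mem_univ, and_true] at y2
  refine ⟨y, ?_, fun a => ?_, ?_⟩
  · simp [y1, y2]
  · simp only [List.mem_cons, y2]
    tauto
  · exact List.pairwise_cons.2 ⟨fun b _ => hi.not_lt, y3⟩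

theorem height_lt_top_of_finite [Finite α] (a : α) : Order.height a < ⊤ := by
  have := Fintype.ofFinite α
  refine lt_top_iff_ne_top.2 fun h => ?_
  obtain ⟨p, -, hp⟩ := Order.height_eq_top_iff.1 h (Fintype.card α)
  have := LTSeries.length_lt_card p
  omega

theorem depth_orderIso {β : Type*} [PartialOrder β] (f : α ≃o β) (a : α) :
    depth (f a) = depth a := by
  rw [depth, depth, Order.height_orderIso]

theorem coe_depth (a : α) : (depth a : ℕ) = (Order.height a).toNat + 1 := rfl

theorem depth_of_isMin {a : α} (ha : IsMin a) : depth a = 1 := by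
  rw [depth, Order.height_eq_zero.2 ha]
  rfl

theorem depth_lt_depth [Finite α] {a b : α} (h : a < b) : depth a < depth b := by
  have h1 := Order.height_strictMono h (height_lt_top_of_finite a)
  rw [← ENat.natCast_toNat (height_lt_top_of_finite a).ne,
    ← ENat.natCast_toNat (height_lt_top_of_finite b).ne, Nat.cast_lt] at h1
  rw [← PNat.coe_lt_coe, coe_depth, coe_depth]
  omega

/-- The depth of an element that is not minimal is attained along a covering relation. -/
theorem exists_covBy_depth [Finite α] {a : α} (ha : ¬ IsMin a) :
    ∃ b, b ⋖ a ∧ (depth a : ℕ) = depth b + 1 := by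
  have hfin := height_lt_top_of_finite a
  obtain ⟨n, hn⟩ := ENat.ne_top_iff_exists.1 hfin.ne
  have hn0 : n ≠ 0 := by
    rintro rfl
    exact ha (Order.height_eq_zero.1 (by rw [← hn]; rfl))
  obtain ⟨k, rfl⟩ := Nat.exists_eq_succ_of_ne_zero hn0
  obtain ⟨-, ⟨b, hb, hbk⟩, -⟩ := (Order.height_eq_coe_add_one_iff (n := k)).1 (by
    rw [← hn]; push_cast; rfl)
  have hd : (depth a : ℕ) = depth b + 1 := by
    rw [coe_depth, coe_depth, hbk, ← hn]
    rfl
  refine ⟨b, ⟨hb, fun c hbc hca => ?_⟩, hd⟩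
  have h1 : (depth b : ℕ) < depth c := depth_lt_depth hbc
  have h2 : (depth c : ℕ) < depth a := depth_lt_depth hca
  omega

end LinearExtensions

/-! ### The roots along a list -/

section ListRoots

variable {B : Type*} [Fintype B] [DecidableEq B] {M : CoxeterMatrix B}
  {W : Type*} [Group W] (cs : CoxeterSystem M W) {α : Type*}

theorem rootForm_eq_zero_of_not_dependent {s t : B} (h : ¬ Dependent cs.simple s t) :
    rootForm M (simpleRoot s) (simpleRoot t) = 0 := by
  simp only [Dependent, not_or, not_not] at h
  exact (commute_simple_iff cs h.1).1 h.2

theorem rootForm_neg_of_dependent {s t : B} (hne : s ≠ t) (h : Dependent cs.simple s t) :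
    rootForm M (simpleRoot s) (simpleRoot t) < 0 :=
  (rootForm_simpleRoot_nonpos hne).lt_of_ne fun h0 =>
    (h.resolve_left hne) ((commute_simple_iff cs hne).2 h0)

open Classical in
/-- For a list `a₁, …, aₖ` of elements labelled by `σ`, the vector `σ(a₁) ⋯ σ(aᵢ₋₁) r_{σ(aᵢ)}`
attached to the element `aᵢ`; elements outside the list get `0`. For repeated elements the first
occurrence counts. -/
noncomputable def listRoot (σ : α → B) : List α → α → B → ℝ
  | [], _ => 0
  | a :: l, b =>
    if b = a then simpleRoot (σ a) else rootAction cs (cs.simple (σ a)) (listRoot σ l b)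

theorem listRoot_cons_self (σ : α → B) (a : α) (l : List α) :
    listRoot cs σ (a :: l) a = simpleRoot (σ a) := if_pos rfl

theorem listRoot_cons_of_ne (σ : α → B) {a b : α} (h : b ≠ a) (l : List α) :
    listRoot cs σ (a :: l) b = rootAction cs (cs.simple (σ a)) (listRoot cs σ l b) := if_neg h

theorem listRoot_append_of_notMem (σ : α → B) {x : List α} (y : List α) {b : α} (h : b ∉ x) :
    listRoot cs σ (x ++ y) b = rootAction cs (cs.wordProd (x.map σ)) (listRoot cs σ y b) := by
  induction x with
  | nil => simp
  | cons c x ih =>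
    rw [List.mem_cons, not_or] at h
    rw [List.cons_append, listRoot_cons_of_ne cs σ h.1, ih h.2, List.map_cons, cs.wordProd_cons,
      rootAction_mul]

theorem listRoot_append_of_mem (σ : α → B) {x : List α} (y : List α) {b : α} (h : b ∈ x) :
    listRoot cs σ (x ++ y) b = listRoot cs σ x b := by
  induction x with
  | nil => simp at h
  | cons c x ih =>
    by_cases hb : b = c
    · subst hb
      rw [List.cons_append, listRoot_cons_self, listRoot_cons_self]
    · rw [List.cons_append, listRoot_cons_of_ne cs σ hb, listRoot_cons_of_ne cs σ hb,
        ih ((List.mem_cons.1 h).resolve_left hb)]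

theorem listRoot_getElem (σ : α → B) {l : List α} (h : l.Nodup) (i : ℕ) (hi : i < l.length) :
    listRoot cs σ l l[i] =
      rootAction cs (cs.wordProd ((l.map σ).take i)) (simpleRoot (σ l[i])) := by
  have hl : l.take i ++ l[i] :: l.drop (i + 1) = l := by
    rw [← List.drop_eq_getElem_cons hi, List.take_append_drop]
  have hn : l[i] ∉ l.take i := by
    have h' := hl ▸ h
    rw [List.nodup_append] at h'
    exact fun hmem => h'.2.2 _ hmem _ List.mem_cons_self rfl
  rw [← congrArg (fun z => listRoot cs σ z l[i]) hl, listRoot_append_of_notMem cs σ _ hn, listRoot_cons_self, List.map_take]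

theorem listRoot_map {β : Type*} (σ : α → B) (τ : β → B) {e : α → β} (he : e.Injective)
    (hστ : ∀ a, τ (e a) = σ a) (l : List α) (a : α) :
    listRoot cs τ (l.map e) (e a) = listRoot cs σ l a := by
  induction l with
  | nil => rfl
  | cons c l ih =>
    by_cases h : a = c
    · subst h
      rw [List.map_cons, listRoot_cons_self, listRoot_cons_self, hστ]
    · rw [List.map_cons, listRoot_cons_of_ne cs τ (he.ne h), listRoot_cons_of_ne cs σ h, ih, hστ]

/-- An element may be moved to the front past elements whose labels commute with its label. -/
theorem listRoot_move_front (σ : α → B) {x : List α} (y : List α) {a : α}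
    (h : ∀ c ∈ x, ¬ Dependent cs.simple (σ c) (σ a)) :
    listRoot cs σ (x ++ a :: y) = listRoot cs σ (a :: (x ++ y)) ∧
      cs.wordProd ((x ++ a :: y).map σ) = cs.wordProd ((a :: (x ++ y)).map σ) := by
  induction x with
  | nil => exact ⟨rfl, rfl⟩
  | cons c x ih =>
    obtain ⟨ih1, ih2⟩ := ih fun d hd => h d (List.mem_cons_of_mem _ hd)
    have hca := h c List.mem_cons_self
    have hform := rootForm_eq_zero_of_not_dependent cs hca
    have hne : a ≠ c := by
      rintro rfl
      exact hca (Or.inl rfl)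
    have hcomm : cs.simple (σ c) * cs.simple (σ a) = cs.simple (σ a) * cs.simple (σ c) := by
      simp only [Dependent, not_or, not_not] at hca
      exact hca.2
    constructor
    · funext b
      by_cases hbc : b = c
      · subst hbc
        rw [List.cons_append, listRoot_cons_self, listRoot_cons_of_ne cs σ hne.symm,
          List.cons_append, listRoot_cons_self, rootAction_simple_of_rootForm_eq_zero]
        rwa [rootForm_comm]
      · rw [List.cons_append, listRoot_cons_of_ne cs σ hbc, ih1]
        by_cases hba : b = a
        · subst hba
          rw [listRoot_cons_self, listRoot_cons_self,
            rootAction_simple_of_rootForm_eq_zero cs hform]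
        · rw [listRoot_cons_of_ne cs σ hba, listRoot_cons_of_ne cs σ hba, List.cons_append,
            listRoot_cons_of_ne cs σ hbc, ← rootAction_mul, ← rootAction_mul, hcomm]
    · simp only [List.cons_append, List.map_cons, cs.wordProd_cons] at ih2 ⊢
      rw [ih2, ← mul_assoc, hcomm, mul_assoc]

/-- Two orderings of the same elements that agree on all pairs with dependent labels yield the same
roots and the same product. -/
theorem listRoot_eq_of_perm (σ : α → B) {R : α → α → Prop}
    (hR : ∀ a b, R a b → R b a → a ≠ b → ¬ Dependent cs.simple (σ a) (σ b)) :
    ∀ {l₁ l₂ : List α}, l₁.Perm l₂ → l₁.Nodup → l₁.Pairwise R → l₂.Pairwise R →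
      listRoot cs σ l₁ = listRoot cs σ l₂ ∧
        cs.wordProd (l₁.map σ) = cs.wordProd (l₂.map σ) := by
  intro l₁
  induction l₁ with
  | nil =>
    intro l₂ hp _ _ _
    rw [List.nil_perm.1 hp]
    exact ⟨rfl, rfl⟩
  | cons a l ih =>
    intro l₂ hp hnd h1 h2
    obtain ⟨x, y, rfl⟩ := List.append_of_mem (hp.subset List.mem_cons_self)
    rw [List.nodup_cons] at hnd
    rw [List.pairwise_cons] at h1
    have hp' : l.Perm (x ++ y) := (List.perm_cons a).1 (hp.trans List.perm_middle)
    rw [List.pairwise_append, List.pairwise_cons] at h2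
    have hx : ∀ c ∈ x, ¬ Dependent cs.simple (σ c) (σ a) := fun c hc => by
      have hcl : c ∈ l := hp'.mem_iff.2 (List.mem_append_left _ hc)
      refine hR c a (h2.2.2 c hc a List.mem_cons_self) (h1.1 c hcl) ?_
      rintro rfl
      exact hnd.1 hcl
    obtain ⟨e1, e2⟩ := listRoot_move_front cs σ y hx
    obtain ⟨i1, i2⟩ := ih hp' hnd.2 h1.2 (List.pairwise_append.2
      ⟨h2.1, h2.2.1.2, fun c hc d hd => h2.2.2 c hc d (List.mem_cons_of_mem _ hd)⟩)
    rw [e1, e2]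
    constructor
    · funext b
      by_cases hb : b = a
      · subst hb
        rw [listRoot_cons_self, listRoot_cons_self]
      · rw [listRoot_cons_of_ne cs σ hb, listRoot_cons_of_ne cs σ hb, i1]
    · rw [List.map_cons, List.map_cons, cs.wordProd_cons, cs.wordProd_cons, i2]

theorem listRoot_bijOn (σ : α → B) (l : List α) (hnd : l.Nodup)
    (hred : cs.IsReduced (l.map σ)) :
    Set.BijOn (listRoot cs σ l) {a | a ∈ l} (inversionSet cs (cs.wordProd (l.map σ))) := by
  induction l using List.reverseRecOn with
  | nil =>
    have h := inversionSet_one_isEmpty cs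
    rw [Set.isEmpty_coe_sort] at h
    simp [h]
  | append_singleton l a ih =>
    rw [List.nodup_append] at hnd
    have ha : a ∉ l := fun h => hnd.2.2 a h a (by simp) rfl
    rw [List.map_append, List.map_singleton] at hred ⊢
    have hdesc := hred.not_isRightDescent
    have hbij := ih hnd.1 (CoxeterSystem.IsReduced.of_append_left cs hred)
    have hset : {b | b ∈ l ++ [a]} = insert a {b | b ∈ l} := by
      ext b
      simp [or_comm]
    have hla : listRoot cs σ (l ++ [a]) a =
        rootAction cs (cs.wordProd (l.map σ)) (simpleRoot (σ a)) := by
      rw [listRoot_append_of_notMem cs σ _ ha, listRoot_cons_self]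
    rw [cs.wordProd_append, cs.wordProd_singleton, inversionSet_mul_simple cs hdesc, hset, ← hla]
    refine Set.BijOn.insert (hbij.congr fun b hb => (listRoot_append_of_mem cs σ _ hb).symm) ?_
    rw [hla]
    exact rootAction_simpleRoot_notMem_inversionSet cs _ _

end ListRoots

/-! ### The roots of a word poset -/

section PosetRoots

variable {B : Type*} [Fintype B] [DecidableEq B] {M : CoxeterMatrix B}
  {W : Type*} [Group W] (cs : CoxeterSystem M W) {P : WordPoset.{v} cs.simple}

/-- The roots do not depend on the linear extension of the word poset along which they are
computed, and neither does the product of the labels. -/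
theorem IsLinearExtension.listRoot_eq {l₁ l₂ : List P.carrier} (h₁ : IsLinearExtension l₁)
    (h₂ : IsLinearExtension l₂) : listRoot cs P.label l₁ = listRoot cs P.label l₂ ∧
      cs.wordProd (l₁.map P.label) = cs.wordProd (l₂.map P.label) := by
  refine listRoot_eq_of_perm cs P.label (R := fun a b => ¬ b < a) (fun a b h h' hne hd => ?_)
    ((List.perm_ext_iff_of_nodup h₁.nodup h₂.nodup).2 fun a => by simp [h₁.mem, h₂.mem])
    h₁.nodup h₁.pairwise h₂.pairwise
  exact (P.comparable a b hd).elim (fun hab => h' (hab.lt_of_ne hne))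
    fun hba => h (hba.lt_of_ne hne.symm)

theorem IsLinearExtension.isReduced {l₁ l₂ : List P.carrier} (h₁ : IsLinearExtension l₁)
    (h₂ : IsLinearExtension l₂) (hred : cs.IsReduced (l₁.map P.label)) :
    cs.IsReduced (l₂.map P.label) := by
  have hlen : l₁.length = l₂.length :=
    ((List.perm_ext_iff_of_nodup h₁.nodup h₂.nodup).2 fun a => by simp [h₁.mem, h₂.mem]).length_eq
  rw [CoxeterSystem.IsReduced, ← (h₁.listRoot_eq cs h₂).2, hred.eq, List.length_map,
    List.length_map, hlen]

theorem IsLinearExtension.rootForm_adjacent {i j : P.carrier} {x y : List P.carrier}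
    (h : IsLinearExtension (x ++ i :: j :: y)) :
    rootForm M (listRoot cs P.label (x ++ i :: j :: y) i)
        (listRoot cs P.label (x ++ i :: j :: y) j) =
      -rootForm M (simpleRoot (P.label i)) (simpleRoot (P.label j)) := by
  have hnd := h.nodup
  simp only [List.nodup_append, List.nodup_cons, List.mem_cons, not_or] at hnd
  have hi : i ∉ x := fun hx => hnd.2.2 i hx i (Or.inl rfl) rfl
  have hj : j ∉ x := fun hx => hnd.2.2 j hx j (Or.inr (Or.inl rfl)) rfl
  have hij : j ≠ i := fun e => hnd.2.1.1.1 e.symm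
  rw [listRoot_append_of_notMem cs _ _ hi, listRoot_append_of_notMem cs _ _ hj,
    rootForm_rootAction, listRoot_cons_self, listRoot_cons_of_ne cs _ hij, listRoot_cons_self,
    rootAction_simple]
  simp only [map_sub, map_smul, rootForm_simpleRoot_self, smul_eq_mul]
  ring

/-- Roots of incomparable elements are orthogonal: the two elements are adjacent in some linear
extension, and their labels commute. -/
theorem IsLinearExtension.rootForm_eq_zero {l : List P.carrier} (h : IsLinearExtension l)
    {i j : P.carrier} (hij : ¬ i ≤ j) (hji : ¬ j ≤ i) :
    rootForm M (listRoot cs P.label l i) (listRoot cs P.label l j) = 0 := by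
  obtain ⟨x, y, h'⟩ := exists_isLinearExtension_adjacent (i := i) (j := j)
    (fun e => hij e.le) (fun e => hji e.le) fun c h1 h2 => hij (h1.trans h2).le
  rw [(h.listRoot_eq cs h').1, h'.rootForm_adjacent cs, neg_eq_zero]
  exact rootForm_eq_zero_of_not_dependent cs fun hd => (P.comparable i j hd).elim hij hji

/-- Along a covering relation of a reduced word poset the roots form an acute angle: the two
elements are adjacent in some linear extension, and their labels are distinct and do not commute. -/
theorem IsLinearExtension.rootForm_pos_of_covBy {l : List P.carrier} (h : IsLinearExtension l)
    (hred : cs.IsReduced (l.map P.label)) {i j : P.carrier} (hij : i ⋖ j) :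
    0 < rootForm M (listRoot cs P.label l i) (listRoot cs P.label l j) := by
  obtain ⟨x, y, h'⟩ := exists_isLinearExtension_adjacent (i := i) (j := j) hij.ne
    (lt_asymm hij.lt) fun c h1 h2 => hij.2 h1 h2
  rw [(h.listRoot_eq cs h').1, h'.rootForm_adjacent cs, neg_pos]
  refine rootForm_neg_of_dependent cs (fun he => ?_) (P.dependent_of_covBy i j hij)
  have hred' := h.isReduced cs h' hred
  rw [List.map_append, List.map_cons, List.map_cons, he] at hred'
  exact cs.not_isReduced_pair _ (CoxeterSystem.IsReduced.of_append_left cs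
    (CoxeterSystem.IsReduced.of_append_right cs (ω' := [P.label j, P.label j] ++ y.map P.label)
      hred'))

theorem IsLinearExtension.listRoot_of_isMin {l : List P.carrier} (h : IsLinearExtension l)
    {i : P.carrier} (hi : IsMin i) : listRoot cs P.label l i = simpleRoot (P.label i) := by
  obtain ⟨y, h'⟩ := exists_isLinearExtension_cons hi
  rw [(h.listRoot_eq cs h').1, listRoot_cons_self]

end PosetRoots

/-! ### Words and their posets -/

section WordRoots

variable {B : Type*} [Fintype B] [DecidableEq B] {M : CoxeterMatrix B}
  {W : Type*} [Group W] (cs : CoxeterSystem M W)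

/-- The positions of a word from left to right, as a list of elements of its word poset. -/
def wordPositions {S M : Type*} [Monoid M] (g : S → M) (ω : List S) : List (WordIndex g ω) :=
  List.finRange ω.length

theorem map_letter_wordPositions {S M : Type*} [Monoid M] (g : S → M) (ω : List S) :
    (wordPositions g ω).map WordIndex.letter = ω :=
  List.map_get_finRange ω

theorem isLinearExtension_wordPositions {S M : Type*} [Monoid M] (g : S → M) (ω : List S) :
    IsLinearExtension (wordPositions g ω) where
  nodup := List.nodup_finRange _
  mem := List.mem_finRange
  pairwise := (List.pairwise_lt_finRange ω.length).imp fun h hlt =>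
    absurd (WordIndex.pos_le_of_transGen (g := g) hlt.le) (not_le_of_gt h)

theorem listRoot_wordPositions (ω : List B) (i : WordIndex cs.simple ω) :
    listRoot cs WordIndex.letter (wordPositions cs.simple ω) i = wordRoot cs ω i := by
  have hi : (i.pos : ℕ) < (wordPositions cs.simple ω).length :=
    i.pos.2.trans_eq List.length_finRange.symm
  have h := listRoot_getElem cs WordIndex.letter
    (isLinearExtension_wordPositions cs.simple ω).nodup i.pos hi
  have hget : (wordPositions cs.simple ω)[(i.pos : ℕ)] = i :=
    List.getElem_finRange hi
  rw [hget, map_letter_wordPositions] at h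
  exact h

theorem wordRoot_bijOn {ω : List B} (hω : cs.IsReduced ω) :
    Set.BijOn (wordRoot cs ω) Set.univ (inversionSet cs (cs.wordProd ω)) := by
  have hl := isLinearExtension_wordPositions cs.simple ω
  have h := listRoot_bijOn cs WordIndex.letter _ hl.nodup
    (by rwa [map_letter_wordPositions])
  rw [map_letter_wordPositions] at h
  have huniv : {i | i ∈ wordPositions cs.simple ω} = Set.univ := Set.eq_univ_of_forall hl.mem
  rw [huniv] at h
  exact h.congr fun i _ => listRoot_wordPositions cs ω i

/-- The roots of a word poset, read off from an identification with the poset of a word, come from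
a linear extension. -/
theorem WordPoset.Iso.exists_linearExtension {P : WordPoset.{v} cs.simple} {ω : List B}
    (f : P.Iso (WordPoset.ofWord cs.simple ω)) : ∃ l : List P.carrier, IsLinearExtension l ∧
      ∀ p, listRoot cs P.label l p = wordRoot cs ω (f.toOrderIso p) := by
  have hl := isLinearExtension_wordPositions cs.simple ω
  let e : WordIndex cs.simple ω ≃o P.carrier := f.toOrderIso.symm
  refine ⟨(wordPositions cs.simple ω).map e, ⟨hl.nodup.map e.injective, fun p => ?_, ?_⟩,
    fun p => ?_⟩
  · exact List.mem_map.2 ⟨e.symm p, hl.mem _, e.apply_symm_apply p⟩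
  · rw [List.pairwise_map]
    exact hl.pairwise.imp fun h hlt => h (e.lt_iff_lt.1 hlt)
  · have h := listRoot_map cs WordIndex.letter P.label e.injective
      (fun i => by
        have h := f.label_eq (e i)
        rw [← h]
        exact congrArg WordIndex.letter (f.toOrderIso.apply_symm_apply i))
      (wordPositions cs.simple ω) (f.toOrderIso p)
    have hp : e (f.toOrderIso p) = p := f.toOrderIso.symm_apply_apply p
    rw [hp] at h
    exact h.trans (listRoot_wordPositions cs ω (f.toOrderIso p))

theorem WordPoset.Iso.wordRoot_eq {P : WordPoset.{v} cs.simple} {ω ω' : List B}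
    (f : P.Iso (WordPoset.ofWord cs.simple ω)) (f' : P.Iso (WordPoset.ofWord cs.simple ω'))
    (p : P.carrier) :
    wordRoot cs ω (f.toOrderIso p) = wordRoot cs ω' (f'.toOrderIso p) := by
  obtain ⟨l, hl, h⟩ := f.exists_linearExtension cs
  obtain ⟨l', hl', h'⟩ := f'.exists_linearExtension cs
  rw [← h, ← h', (hl.listRoot_eq cs hl').1]

theorem posetRoot_eq {w : W} {P : WordPoset.{v} cs.simple} (hP : IsReducedWordPoset cs w P)
    {ω : List B} (f : P.Iso (WordPoset.ofWord cs.simple ω)) (p : P.carrier) :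
    posetRoot cs hP p = wordRoot cs ω (f.toOrderIso p) :=
  WordPoset.Iso.wordRoot_eq cs _ f p

theorem posetRoot_bijOn {w : W} {P : WordPoset.{v} cs.simple} (hP : IsReducedWordPoset cs w P) :
    Set.BijOn (posetRoot cs hP) Set.univ (inversionSet cs w) := by
  obtain ⟨ω, hω, rfl, ⟨f⟩⟩ := id hP
  have hf : Set.BijOn f.toOrderIso Set.univ (Set.univ : Set (WordIndex cs.simple ω)) :=
    f.toOrderIso.bijective.bijOn_univ
  exact ((wordRoot_bijOn cs hω).comp hf).congr fun p _ => (posetRoot_eq cs hP f p).symm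

/-! ### Appending a letter to a word -/

/-- The position of the longer word `ω s` that corresponds to a position of `ω`. -/
def WordIndex.castSucc {S M : Type*} [Monoid M] {g : S → M} {ω : List S} (s : S)
    (i : WordIndex g ω) : WordIndex g (ω ++ [s]) :=
  (⟨i.pos, by have := i.pos.2; simp only [List.length_append, List.length_singleton]; omega⟩ : Fin (ω ++ [s]).length)

/-- The last position of the word `ω s`. -/
def WordIndex.last {S M : Type*} [Monoid M] (g : S → M) (ω : List S) (s : S) :
    WordIndex g (ω ++ [s]) :=
  (⟨ω.length, by simp⟩ : Fin (ω ++ [s]).length)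

section

variable {S N : Type*} [Monoid N] {g : S → N} {ω : List S} {s : S}

@[simp] theorem WordIndex.pos_castSucc (i : WordIndex g ω) :
    ((i.castSucc s).pos : ℕ) = i.pos := rfl

@[simp] theorem WordIndex.pos_last : ((WordIndex.last g ω s).pos : ℕ) = ω.length := rfl

@[simp] theorem WordIndex.letter_castSucc (i : WordIndex g ω) :
    (i.castSucc s).letter = i.letter := by
  change (ω ++ [s])[(i.pos : ℕ)]'_ = ω[(i.pos : ℕ)]
  exact List.getElem_append_left i.pos.2

@[simp] theorem WordIndex.letter_last : (WordIndex.last g ω s).letter = s := by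
  change (ω ++ [s])[ω.length]'_ = s
  simp

theorem WordIndex.exists_castSucc {i : WordIndex g (ω ++ [s])} (h : (i.pos : ℕ) < ω.length) :
    ∃ j : WordIndex g ω, j.castSucc s = i :=
  ⟨(⟨i.pos, h⟩ : Fin ω.length), rfl⟩

theorem WordIndex.eq_castSucc_or_eq_last (i : WordIndex g (ω ++ [s])) :
    (∃ j : WordIndex g ω, j.castSucc s = i) ∨ i = WordIndex.last g ω s := by
  have h := i.pos.2
  simp only [List.length_append, List.length_singleton] at h
  rcases (Nat.lt_succ_iff_lt_or_eq.1 h) with h | h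
  · exact Or.inl (WordIndex.exists_castSucc h)
  · exact Or.inr (Fin.ext (a := i.pos) h)

theorem WordIndex.arrow_castSucc_iff {i j : WordIndex g ω} :
    (i.castSucc s).Arrow (j.castSucc s) ↔ i.Arrow j := by
  simp only [WordIndex.Arrow, WordIndex.letter_castSucc]
  exact Iff.rfl

theorem WordIndex.castSucc_le_iff {i j : WordIndex g ω} :
    i.castSucc s ≤ j.castSucc s ↔ i ≤ j := by
  constructor
  · intro h
    have h' : Relation.TransGen WordIndex.Arrow (i.castSucc s) (j.castSucc s) := h
    generalize hk : i.castSucc s = k at h'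
    clear h
    induction h' using Relation.TransGen.head_induction_on generalizing i with
    | single h =>
      subst hk
      exact WordIndex.le_of_arrow (WordIndex.arrow_castSucc_iff.1 h)
    | @head a c hac hcj ih =>
      subst hk
      have hc := WordIndex.pos_le_of_transGen hcj
      obtain ⟨c, rfl⟩ := WordIndex.exists_castSucc (i := c)
        (lt_of_le_of_lt (Fin.le_def.1 hc) j.pos.2)
      exact (WordIndex.le_of_arrow (WordIndex.arrow_castSucc_iff.1 hac)).trans (ih rfl)
  · intro h
    have h' : Relation.TransGen WordIndex.Arrow i j := h
    induction h' with
    | single hab => exact WordIndex.le_of_arrow (WordIndex.arrow_castSucc_iff.2 hab)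
    | tail hab hbc ih =>
      exact (ih hab).trans (WordIndex.le_of_arrow (WordIndex.arrow_castSucc_iff.2 hbc))

theorem WordIndex.castSucc_lt_iff {i j : WordIndex g ω} :
    i.castSucc s < j.castSucc s ↔ i < j := by
  simp only [lt_iff_le_not_ge, WordIndex.castSucc_le_iff]

theorem WordIndex.not_last_le_castSucc (i : WordIndex g ω) :
    ¬ WordIndex.last g ω s ≤ i.castSucc s := fun h => by
  have h1 := WordIndex.pos_le_of_transGen h
  exact absurd (Fin.le_def.1 h1) (not_le_of_gt i.pos.2)

/-- The old positions form a lower set of the poset of `ω s`, so their depths do not change. -/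
theorem WordIndex.depth_castSucc (i : WordIndex g ω) : depth (i.castSucc s) = depth i := by
  rw [depth, depth, ← Order.height_eq_of_strictMono (WordIndex.castSucc s)
    (fun _ _ h => WordIndex.castSucc_lt_iff.2 h) fun a b hb => ?_]
  rcases b.eq_castSucc_or_eq_last with ⟨c, rfl⟩ | rfl
  · exact ⟨c, WordIndex.castSucc_lt_iff.1 hb, rfl⟩
  · exact absurd hb.le (WordIndex.not_last_le_castSucc a)

end

theorem wordRoot_castSucc {ω : List B} {s : B} (i : WordIndex cs.simple ω) :
    wordRoot cs (ω ++ [s]) (i.castSucc s) = wordRoot cs ω i := by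
  rw [wordRoot, wordRoot, WordIndex.letter_castSucc, WordIndex.pos_castSucc,
    List.take_append_of_le_length i.pos.2.le]

theorem wordRoot_last (ω : List B) (s : B) :
    wordRoot cs (ω ++ [s]) (WordIndex.last cs.simple ω s) =
      rootAction cs (cs.wordProd ω) (simpleRoot s) := by
  rw [wordRoot, WordIndex.letter_last, WordIndex.pos_last, List.take_left]

theorem rootForm_wordRoot_eq_zero {ω : List B} {i j : WordIndex cs.simple ω} (hij : ¬ i ≤ j)
    (hji : ¬ j ≤ i) : rootForm M (wordRoot cs ω i) (wordRoot cs ω j) = 0 := by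
  rw [← listRoot_wordPositions, ← listRoot_wordPositions]
  exact IsLinearExtension.rootForm_eq_zero cs (P := WordPoset.ofWord cs.simple ω)
    (isLinearExtension_wordPositions cs.simple ω) hij hji

theorem rootForm_wordRoot_pos_of_covBy {ω : List B} (hω : cs.IsReduced ω)
    {i j : WordIndex cs.simple ω} (hij : i ⋖ j) :
    0 < rootForm M (wordRoot cs ω i) (wordRoot cs ω j) := by
  rw [← listRoot_wordPositions, ← listRoot_wordPositions]
  refine IsLinearExtension.rootForm_pos_of_covBy cs (P := WordPoset.ofWord cs.simple ω)
    (isLinearExtension_wordPositions cs.simple ω) ?_ hij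
  change cs.IsReduced ((wordPositions cs.simple ω).map WordIndex.letter)
  rwa [map_letter_wordPositions]

theorem wordRoot_of_isMin {ω : List B} {i : WordIndex cs.simple ω} (hi : IsMin i) :
    wordRoot cs ω i = simpleRoot i.letter := by
  rw [← listRoot_wordPositions]
  exact IsLinearExtension.listRoot_of_isMin cs (P := WordPoset.ofWord cs.simple ω)
    (isLinearExtension_wordPositions cs.simple ω) hi

/-! ### Depth functions and the sets `C(w)` -/

/-- The function `λ` on `R(w)` records the depths in the poset of the word `ω`: at the root of a
position of `ω` it takes the depth of that position. -/
def IsWordDepth {w : W} (ω : List B) (lam : inversionSet cs w → ℕ+) : Prop :=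
  ∀ (i : WordIndex cs.simple ω) (r : inversionSet cs w), wordRoot cs ω i = r → lam r = depth i

theorem exists_wordRoot_eq {ω : List B} (hω : cs.IsReduced ω)
    (r : inversionSet cs (cs.wordProd ω)) :
    ∃ i : WordIndex cs.simple ω, wordRoot cs ω i = r := by
  obtain ⟨i, -, hi⟩ := (wordRoot_bijOn cs hω).surjOn r.2
  exact ⟨i, hi⟩

theorem exists_isWordDepth {ω : List B} (hω : cs.IsReduced ω) :
    ∃ lam : inversionSet cs (cs.wordProd ω) → ℕ+, IsWordDepth cs ω lam := by
  choose i hi using exists_wordRoot_eq cs hω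
  refine ⟨fun r => depth (i r), fun j r hj => ?_⟩
  change depth (i r) = depth j
  rw [(wordRoot_bijOn cs hω).injOn (Set.mem_univ _) (Set.mem_univ _) ((hi r).trans hj.symm)]

theorem IsWordDepth.unique {ω : List B} (hω : cs.IsReduced ω)
    {lam lam' : inversionSet cs (cs.wordProd ω) → ℕ+} (h : IsWordDepth cs ω lam)
    (h' : IsWordDepth cs ω lam') : lam = lam' := by
  funext r
  obtain ⟨i, hi⟩ := exists_wordRoot_eq cs hω r
  rw [h i r hi, h' i r hi]

/-- Appending a letter to a reduced word turns the depth function `λ` into `Φ(λ, s)`. The new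
position `m` is maximal, so a root that is not orthogonal to its root `r` belongs to a position
below `m`. If `m` is minimal as well, `r` is therefore simple and orthogonal to `R(w)`. Otherwise
some position covered by `m` has depth one less than `m`, and its root forms an acute angle with
`r`. -/
theorem IsWordDepth.extendFun {ω : List B} {s : B} (hω : cs.IsReduced (ω ++ [s]))
    {lam : inversionSet cs (cs.wordProd ω) → ℕ+} (hlam : IsWordDepth cs ω lam) :
    IsWordDepth cs (ω ++ [s]) (extendFun cs (cs.wordProd ω) s lam) := by
  have hω' := CoxeterSystem.IsReduced.of_append_left cs hω
  rintro i ⟨r, hr⟩ rfl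
  rcases i.eq_castSucc_or_eq_last with ⟨j, rfl⟩ | rfl
  · have hmem : wordRoot cs ω j ∈ inversionSet cs (cs.wordProd ω) :=
      (wordRoot_bijOn cs hω').mapsTo (Set.mem_univ j)
    have hmem' := hmem
    rw [← wordRoot_castSucc cs (s := s) j] at hmem'
    rw [WordIndex.depth_castSucc, _root_.extendFun, dif_pos hmem']
    exact hlam j _ (wordRoot_castSucc cs j).symm
  · set m := WordIndex.last cs.simple ω s with hm
    have hnot : wordRoot cs (ω ++ [s]) m ∉ inversionSet cs (cs.wordProd ω) := by
      rw [hm, wordRoot_last]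
      exact rootAction_simpleRoot_notMem_inversionSet cs _ s
    have hlt : ∀ r' : inversionSet cs (cs.wordProd ω),
        0 < rootForm M (wordRoot cs (ω ++ [s]) m) r' →
          ∃ j : WordIndex cs.simple ω, j.castSucc s < m ∧ lam r' = depth j := by
      intro r' hpos
      obtain ⟨j, hj⟩ := exists_wordRoot_eq cs hω' r'
      refine ⟨j, ?_, hlam j r' hj⟩
      rw [← hj, ← wordRoot_castSucc cs (s := s) j] at hpos
      refine lt_of_le_not_ge ?_ (WordIndex.not_last_le_castSucc j)
      by_contra hle
      have h0 := rootForm_wordRoot_eq_zero cs (i := m) (j := j.castSucc s)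
        (WordIndex.not_last_le_castSucc j) hle
      exact hpos.ne' h0
    rw [_root_.extendFun, dif_neg hnot]
    by_cases hmin : IsMin m
    · rw [if_pos, depth_of_isMin hmin]
      refine ⟨⟨_, wordRoot_of_isMin cs hmin⟩, fun r' hpos => ?_⟩
      obtain ⟨j, hj, -⟩ := hlt r' hpos
      exact hmin.not_lt hj
    · obtain ⟨b, hbm, hdepth⟩ := exists_covBy_depth hmin
      obtain ⟨j, rfl⟩ : ∃ j : WordIndex cs.simple ω, j.castSucc s = b :=
        (WordIndex.eq_castSucc_or_eq_last b).resolve_right hbm.lt.ne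
      have hj : wordRoot cs ω j ∈ inversionSet cs (cs.wordProd ω) :=
        (wordRoot_bijOn cs hω').mapsTo (Set.mem_univ j)
      have hpos : 0 < rootForm M (wordRoot cs (ω ++ [s]) m) (wordRoot cs ω j) := by
        rw [← wordRoot_castSucc cs (s := s) j, rootForm_comm]
        exact rootForm_wordRoot_pos_of_covBy cs hω hbm
      rw [if_neg fun h => h.2 ⟨_, hj⟩ hpos]
      have hgreatest : IsGreatest {n : ℕ | ∃ r' : inversionSet cs (cs.wordProd ω),
          0 < rootForm M (wordRoot cs (ω ++ [s]) m) (r' : B → ℝ) ∧ n = lam r'}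
          (depth (j.castSucc s)) := by
        refine ⟨⟨⟨_, hj⟩, hpos, ?_⟩, ?_⟩
        · rw [hlam j _ rfl, WordIndex.depth_castSucc]
        · rintro n ⟨r', hr', rfl⟩
          obtain ⟨k, hk, hk'⟩ := hlt r' hr'
          have h1 : (depth (k.castSucc s) : ℕ) < depth m := depth_lt_depth hk
          rw [hk', ← WordIndex.depth_castSucc (s := s) k]
          omega
      refine PNat.coe_injective ?_
      rw [hgreatest.csSup_eq, hdepth]
      rfl

/-- The set `C(w)` consists of the depth functions of the reduced words for `w`. -/
theorem isC_iff {w : W} {lam : inversionSet cs w → ℕ+} :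
    IsC cs w lam ↔ ∃ ω, cs.IsReduced ω ∧ cs.wordProd ω = w ∧ IsWordDepth cs ω lam := by
  constructor
  · intro h
    induction h with
    | one =>
      exact ⟨[], by simp [CoxeterSystem.IsReduced], cs.wordProd_nil, fun i => i.pos.elim0⟩
    | step w s hs lam hlam ih =>
      obtain ⟨ω, hω, rfl, hd⟩ := ih
      have hω' := hω.append_singleton cs hs
      exact ⟨ω ++ [s], hω', by rw [cs.wordProd_append, cs.wordProd_singleton],
        hd.extendFun cs hω'⟩
  · rintro ⟨ω, hω, rfl, hd⟩
    induction ω using List.reverseRecOn with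
    | nil =>
      have h : ∀ (x : W) (hx : x = 1) (lam : inversionSet cs x → ℕ+), IsC cs x lam := by
        rintro x rfl lam
        have := inversionSet_one_isEmpty cs
        rw [Subsingleton.elim lam]
        exact IsC.one
      exact h _ cs.wordProd_nil lam
    | append_singleton ω s ih =>
      have hω' := CoxeterSystem.IsReduced.of_append_left cs hω
      obtain ⟨lam', hlam'⟩ := exists_isWordDepth cs hω'
      have hstep := IsC.step _ s hω.not_isRightDescent lam' (ih hω' hlam')
      have hext := hlam'.extendFun cs hω
      -- The domain of `λ` depends on the group element, so the equation between the two
      -- expressions for it is used in this generalized form.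
      have h : ∀ (x : W) (hx : x = cs.wordProd (ω ++ [s])) (mu : inversionSet cs x → ℕ+),
          IsC cs x mu → IsWordDepth cs (ω ++ [s]) mu → IsC cs (cs.wordProd (ω ++ [s])) lam := by
        rintro x rfl mu hC hmu
        rwa [hd.unique cs hω hmu]
      exact h _ (by rw [cs.wordProd_append, cs.wordProd_singleton]) _ hstep hext

theorem isWordDepth_depthFunction {w : W} {P : WordPoset.{v} cs.simple}
    (hP : IsReducedWordPoset cs w P) {ω : List B} (f : P.Iso (WordPoset.ofWord cs.simple ω)) :
    IsWordDepth cs ω (depthFunction cs hP) := by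
  intro i r hi
  have hroot : posetRoot cs hP (f.toOrderIso.symm i) = r := by
    rw [posetRoot_eq cs hP f]
    exact (congrArg (wordRoot cs ω) (f.toOrderIso.apply_symm_apply i)).trans hi
  have hex : ∃ p, posetRoot cs hP p = r := ⟨_, hroot⟩
  rw [depthFunction, dif_pos hex, (posetRoot_bijOn cs hP).injOn (Set.mem_univ _) (Set.mem_univ _)
    (hex.choose_spec.trans hroot.symm)]
  exact depth_orderIso f.toOrderIso.symm i

/-- Every word poset has an isomorphic copy in any larger universe. -/
def WordPoset.ulift.{a, b, c, d} {S : Type a} {N : Type b} [Monoid N] {g : S → N}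
    (P : WordPoset.{d} g) : WordPoset.{max c d} g where
  carrier := ULift.{c} P.carrier
  label p := P.label p.down
  comparable p q h := P.comparable p.down q.down h
  dependent_of_covBy p q h := P.dependent_of_covBy p.down q.down
    ((apply_covBy_apply_iff (ULift.orderIso.{c, d} (α := P.carrier))).2 h)

/-- The canonical isomorphism from the copy. -/
def WordPoset.uliftIso.{a, b, c, d} {S : Type a} {N : Type b} [Monoid N] {g : S → N}
    (P : WordPoset.{d} g) : (WordPoset.ulift.{a, b, c, d} P).Iso P where
  toOrderIso := ULift.orderIso
  label_eq _ := rfl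

end WordRoots

theorem theorem2p2 {B : Type u} [Fintype B] [DecidableEq B] {M : CoxeterMatrix B}
    {W : Type t} [Group W] (cs : CoxeterSystem M W) (w : W) :
    (∀ (P : WordPoset.{v} cs.simple) (hP : IsReducedWordPoset cs w P),
      (∀ (ω : List B) (f : P.Iso (WordPoset.ofWord cs.simple ω)) (p : P.carrier),
        posetRoot cs hP p = wordRoot cs ω (f.toOrderIso p)) ∧
      Set.BijOn (posetRoot cs hP) Set.univ (inversionSet cs w)) ∧
    C cs w = {lam | ∃ (P : WordPoset.{v} cs.simple) (hP : IsReducedWordPoset cs w P),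
      lam = depthFunction cs hP} := by
  refine ⟨fun P hP => ⟨fun ω f p => posetRoot_eq cs hP f p, posetRoot_bijOn cs hP⟩, ?_⟩
  ext lam
  constructor
  · intro h
    obtain ⟨ω, hω, rfl, hd⟩ := (isC_iff cs).1 h
    let f := WordPoset.uliftIso.{u, t, v, 0} (WordPoset.ofWord cs.simple ω)
    exact ⟨_, ⟨ω, hω, rfl, ⟨f⟩⟩, hd.unique cs hω (isWordDepth_depthFunction cs _ f)⟩
  · rintro ⟨P, hP, rfl⟩
    obtain ⟨ω, hω, rfl, ⟨f⟩⟩ := id hP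
    exact (isC_iff cs).2 ⟨ω, hω, rfl, isWordDepth_depthFunction cs hP f⟩
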